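/- Let $L$ be a completely regular frame: a complete lattice in which $a\wedge\bigvee S=\bigvee\{a\wedge s\mid s\in S\}$ for all $a\in L$, $S\subseteq L$, and in which every $a\in L$ is the join of all $x\in L$ with $x\prec\!\prec a$. Here $a\prec b$ means that $a\wedge t=0$ and $t\vee b=1$ for some $t\in L$, and $a\prec\!\prec b$ means that there are elements $c_q\in L$ ($q\in\mathbb Q\cap[0,1]$) with $c_0=a$, $c_1=b$ and $c_r\prec c_s$ whenever $r<s$. Let $\mathcal L(\mathbb R)$ be the frame of reals, that is, the frame generated by the pairs $(p,q)$ of rationals subject to (R1) $(p,q)\wedge(r,s)=(p\vee r,q\wedge s)$; (R2) $(p,q)\vee(r,s)=(p,s)$ whenever $p\le r<q\le s$; (R3) $(p,q)=\bigvee\{(r,s)\mid p<r<s<q\}$; (R4) $1=\bigvee\{(p,q)\mid p,q\in\mathbb Q\}$. Let $\mathcal RL$ be the set of frame homomorphisms $\mathcal L(\mathbb R)\to L$. A cozero element of $L$ is an element of the form $\operatorname{coz}\varphi=\bigvee\{\varphi(p,0)\vee\varphi(0,q)\mid p,q\in\mathbb Q\}$ with $\varphi\in\mathcal RL$. The frame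 $L$ is pseudocompact if for every $\varphi\in\mathcal RL$ there are $p,q\in\mathbb Q$ with $\varphi(p,q)=1$; it is compact if its top element is compact, that is, every $S\subseteq L$ with $\bigvee S=1$ has a finite subset $F$ with $\bigvee F=1$. Call $L$ a $P_F$-frame if, whenever $a,b\in L$ are cozero elements with $a\wedge b=0$, at least one of $a$, $b$ is complemented in $L$. If $L$ is a compact $P_F$-frame, then $L$ is finite. More generally, if $L$ is a pseudocompact $P_F$-frame, then $L$ is finite. -/

import Mathlib

universe u

/-- The frame of reals `𝓛(ℝ)`: the frame presented by generators `(p, q)`, `p q : ℚ`, and relations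
* (R1) `(p, q) ∧ (r, s) = (p ∨ r, q ∧ s)`;
* (R2) `(p, q) ∨ (r, s) = (p, s)` whenever `p ≤ r < q ≤ s`;
* (R3) `(p, q) = ⋁ {(r, s) | p < r < s < q}`;
* (R4) `1 = ⋁ {(p, q) | p q : ℚ}`.

By (R1) the generators form a meet-semilattice, so the presented frame is realised by the sets of
generators that are downward closed and saturated for the covers (R2) and (R3), ordered by
inclusion; the universal property is `FrameOfReals.lift`, `FrameOfReals.lift_gen` and
`FrameOfReals.hom_ext` below. -/
@[ext]
structure FrameOfReals where
  carrier : Set (ℚ × ℚ)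
  lower : ∀ p q r s : ℚ, (p, q) ∈ carrier → p ≤ r → s ≤ q → (r, s) ∈ carrier
  glue : ∀ p q r s : ℚ, p ≤ r → r < q → q ≤ s →
    (p, q) ∈ carrier → (r, s) ∈ carrier → (p, s) ∈ carrier
  round : ∀ p q : ℚ, (∀ r s : ℚ, p < r → r < s → s < q → (r, s) ∈ carrier) → (p, q) ∈ carrier

namespace FrameOfReals

instance : PartialOrder FrameOfReals :=
  PartialOrder.lift carrier (fun _ _ h => FrameOfReals.ext h)

theorem le_def {I J : FrameOfReals} : I ≤ J ↔ I.carrier ⊆ J.carrier := Iff.rfl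

instance : InfSet FrameOfReals where
  sInf S :=
    { carrier := {x | ∀ I ∈ S, x ∈ I.carrier}
      lower := fun p q r s h h1 h2 I hI => I.lower p q r s (h I hI) h1 h2
      glue := fun p q r s h1 h2 h3 h4 h5 I hI => I.glue p q r s h1 h2 h3 (h4 I hI) (h5 I hI)
      round := fun p q h I hI => I.round p q (fun r s h1 h2 h3 => h r s h1 h2 h3 I hI) }

theorem mem_sInf {S : Set FrameOfReals} {x : ℚ × ℚ} :
    x ∈ (sInf S).carrier ↔ ∀ I ∈ S, x ∈ I.carrier := Iff.rfl

instance : CompleteLattice FrameOfReals :=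
  completeLatticeOfInf FrameOfReals (fun S =>
    ⟨fun I hI _ hx => hx I hI, fun _ hJ _ hx I hI => hJ hI hx⟩)

theorem mem_inf {I J : FrameOfReals} {x : ℚ × ℚ} :
    x ∈ (I ⊓ J).carrier ↔ x ∈ I.carrier ∧ x ∈ J.carrier := by
  constructor
  · intro h
    exact ⟨le_def.1 inf_le_left h, le_def.1 inf_le_right h⟩
  · rintro ⟨h1, h2⟩ K hK
    rcases hK with rfl | rfl
    exacts [h1, h2]

/-- The largest `K` with `I ⊓ K ≤ J`. -/
def residual (I J : FrameOfReals) : FrameOfReals where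
  carrier := {x | ∀ r s : ℚ, (r, s) ∈ I.carrier → (max x.1 r, min x.2 s) ∈ J.carrier}
  lower := fun p q r s h h1 h2 a b hab =>
    J.lower _ _ _ _ (h a b hab) (max_le_max h1 le_rfl) (min_le_min h2 le_rfl)
  glue := by
    intro p q r s h1 h2 h3 h4 h5 a b hab
    have h4' := h4 a b hab
    have h5' := h5 a b hab
    simp only at h4' h5' ⊢
    by_cases h : max r a < min q b
    · exact J.glue _ _ _ _ (max_le_max h1 le_rfl) h (min_le_min h3 le_rfl) h4' h5'
    · rw [not_lt, min_le_iff, le_max_iff, le_max_iff] at h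
      by_cases hqa : q ≤ a
      · refine J.lower _ _ _ _ h5' ?_ le_rfl
        exact max_le ((h2.le.trans hqa).trans (le_max_right _ _)) (le_max_right _ _)
      · by_cases hbr : b ≤ r
        · refine J.lower _ _ _ _ h4' le_rfl ?_
          exact le_min ((min_le_right _ _).trans (hbr.trans h2.le)) (min_le_right _ _)
        · have hba : b ≤ a := by
            rcases h with (h | h) | (h | h)
            · exact absurd h (not_le.2 h2)
            · exact absurd h hqa
            · exact absurd h hbr
            · exact h
          refine J.round _ _ (fun c d hc hcd hd => ?_)
          have h6 := (max_lt_iff.1 hc).2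
          have h7 := (lt_min_iff.1 hd).2
          linarith
  round := by
    intro p q h a b hab
    refine J.round _ _ (fun c d hc hcd hd => ?_)
    have hc' := max_lt_iff.1 hc
    have hd' := lt_min_iff.1 hd
    have := h c d hc'.1 hcd hd'.1 a b hab
    rwa [max_eq_left hc'.2.le, min_eq_left hd'.2.le] at this

theorem le_residual {I J K : FrameOfReals} : K ≤ residual I J ↔ I ⊓ K ≤ J := by
  constructor
  · rintro h ⟨p, q⟩ hx
    have hx' := mem_inf.1 hx
    have := h hx'.2 p q hx'.1
    simpa using this
  · rintro h ⟨p, q⟩ hx r s hrs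
    exact h (mem_inf.2 ⟨I.lower _ _ _ _ hrs (le_max_right _ _) (min_le_right _ _),
      K.lower _ _ _ _ hx (le_max_left _ _) (min_le_left _ _)⟩)

instance : Order.Frame FrameOfReals :=
  Order.Frame.ofMinimalAxioms
    { inf_sSup_le_iSup_inf := fun I S =>
        le_residual.1 (sSup_le fun K hK =>
          le_residual.2 (le_iSup₂ (f := fun K (_ : K ∈ S) => I ⊓ K) K hK)) }

/-- The generator `(p, q)` of `𝓛(ℝ)`. -/
def gen (p q : ℚ) : FrameOfReals := sInf {I | (p, q) ∈ I.carrier}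

theorem gen_le {p q : ℚ} {I : FrameOfReals} : gen p q ≤ I ↔ (p, q) ∈ I.carrier :=
  ⟨fun h => h (fun _ hJ => hJ), fun h => sInf_le h⟩

theorem eq_iSup_gen (I : FrameOfReals) : I = ⨆ x ∈ I.carrier, gen x.1 x.2 := by
  apply le_antisymm
  · intro x hx
    exact gen_le.1 (le_iSup₂ (f := fun (x : ℚ × ℚ) (_ : x ∈ I.carrier) => gen x.1 x.2) x hx)
  · exact iSup₂_le fun x hx => gen_le.2 hx

/-- The relations (R1)-(R4) for a family of elements of a frame indexed by pairs of rationals. -/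
structure Relations {L : Type u} [Order.Frame L] (f : ℚ → ℚ → L) : Prop where
  r1 : ∀ p q r s : ℚ, f p q ⊓ f r s = f (max p r) (min q s)
  r2 : ∀ p q r s : ℚ, p ≤ r → r < q → q ≤ s → f p q ⊔ f r s = f p s
  r3 : ∀ p q : ℚ, f p q = sSup {x | ∃ r s : ℚ, p < r ∧ r < s ∧ s < q ∧ x = f r s}
  r4 : sSup {x | ∃ p q : ℚ, x = f p q} = ⊤

theorem gen_mono {p q r s : ℚ} (h1 : p ≤ r) (h2 : s ≤ q) : gen r s ≤ gen p q :=
  gen_le.2 ((gen p q).lower _ _ _ _ (gen_le.1 le_rfl) h1 h2)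

/-- The generator `(p, q)`, computed. -/
def principal (p q : ℚ) : FrameOfReals where
  carrier := {x | x.2 ≤ x.1 ∨ (p ≤ x.1 ∧ x.2 ≤ q)}
  lower := by
    rintro a b c d (h | ⟨h1, h2⟩) h3 h4
    · exact Or.inl (h4.trans (le_trans h h3))
    · exact Or.inr ⟨le_trans h1 h3, h4.trans h2⟩
  glue := by
    rintro a b c d h1 h2 h3 (h4 | h4) (h5 | h5)
    · exact absurd h4 (not_le.2 (h1.trans_lt h2))
    · exact absurd h4 (not_le.2 (h1.trans_lt h2))
    · exact absurd h5 (not_le.2 (h2.trans_le h3))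
    · exact Or.inr ⟨h4.1, h5.2⟩
  round := by
    intro a b h
    rcases le_or_gt b a with hab | hab
    · exact Or.inl hab
    · refine Or.inr ⟨?_, ?_⟩
      · refine le_of_forall_gt_imp_ge_of_dense (fun c hc => ?_)
        by_contra hcp
        obtain ⟨e, he1, he2⟩ := exists_between (lt_min hc hab)
        obtain ⟨d, hd1, hd2⟩ := exists_between (lt_min_iff.1 he2).2
        rcases h e d he1 hd1 hd2 with h' | h'
        · exact absurd h' (not_le.2 hd1)
        · exact hcp (h'.1.trans (lt_min_iff.1 he2).1.le)
      · refine le_of_forall_lt_imp_le_of_dense (fun c hc => ?_)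
        by_contra hcp
        obtain ⟨e, he1, he2⟩ := exists_between (max_lt hc hab)
        obtain ⟨d, hd1, hd2⟩ := exists_between (max_lt_iff.1 he1).2
        rcases h d e hd1 hd2 he2 with h' | h'
        · exact absurd h' (not_le.2 hd2)
        · exact hcp ((max_lt_iff.1 he1).1.le.trans h'.2)

theorem relations_gen : Relations gen where
  r1 p q r s := by
    refine le_antisymm ?_ (le_inf (gen_mono (le_max_left _ _) (min_le_left _ _))
      (gen_mono (le_max_right _ _) (min_le_right _ _)))
    have h : gen r s ≤ residual (gen p q) (gen (max p r) (min q s)) := by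
      have h' : gen p q ≤ principal p q := gen_le.2 (Or.inr ⟨le_rfl, le_rfl⟩)
      rw [gen_le]
      intro a b hab
      rcases h' hab with h | ⟨h1, h2⟩
      · refine FrameOfReals.round _ _ _ (fun c d hc hcd hd => ?_)
        have h6 := (max_lt_iff.1 hc).2
        have h7 := (lt_min_iff.1 hd).2
        simp only at h
        linarith
      · refine gen_le.1 (gen_mono ?_ ?_)
        · rw [max_comm]
          exact max_le_max le_rfl h1
        · rw [min_comm q]
          exact min_le_min le_rfl h2
    exact le_residual.1 h
  r2 p q r s h1 h2 h3 := by
    apply le_antisymm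
    · exact sup_le (gen_mono le_rfl h3) (gen_mono h1 le_rfl)
    · rw [gen_le]
      exact (gen p q ⊔ gen r s).glue _ _ _ _ h1 h2 h3 (gen_le.1 le_sup_left)
        (gen_le.1 le_sup_right)
  r3 p q := by
    apply le_antisymm
    · rw [gen_le]
      refine FrameOfReals.round _ _ _ (fun r s h1 h2 h3 => gen_le.1 (le_sSup ⟨r, s, h1, h2, h3, rfl⟩))
    · apply sSup_le
      rintro x ⟨r, s, h1, h2, h3, rfl⟩
      exact gen_mono h1.le h3.le
  r4 := by
    refine eq_top_iff.2 (fun x _ => gen_le.1 (le_sSup ⟨x.1, x.2, rfl⟩))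

theorem Relations.mono {L : Type u} [Order.Frame L] {f : ℚ → ℚ → L} (hf : Relations f)
    {p q r s : ℚ} (h1 : p ≤ r) (h2 : s ≤ q) : f r s ≤ f p q := by
  have h := hf.r1 p q r s
  rw [max_eq_right h1, min_eq_right h2] at h
  exact inf_eq_right.1 h

/-- The universal property of `𝓛(ℝ)`, existence: a family in a frame `L` that satisfies (R1)-(R4)
extends to a frame homomorphism `𝓛(ℝ) → L`. -/
def lift {L : Type u} [Order.Frame L] (f : ℚ → ℚ → L) (hf : Relations f) :
    FrameHom FrameOfReals L where
  toFun I := ⨆ x ∈ I.carrier, f x.1 x.2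
  map_inf' I J := by
    apply le_antisymm
    · refine iSup₂_le (fun x hx => le_inf ?_ ?_)
      · exact le_iSup₂ (f := fun (x : ℚ × ℚ) (_ : x ∈ I.carrier) => f x.1 x.2) x (mem_inf.1 hx).1
      · exact le_iSup₂ (f := fun (x : ℚ × ℚ) (_ : x ∈ J.carrier) => f x.1 x.2) x (mem_inf.1 hx).2
    · rw [iSup₂_inf_eq]
      refine iSup₂_le (fun x hx => ?_)
      rw [inf_iSup₂_eq]
      refine iSup₂_le (fun y hy => ?_)
      rw [hf.r1]
      exact le_iSup₂ (f := fun (x : ℚ × ℚ) (_ : x ∈ (I ⊓ J).carrier) => f x.1 x.2)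
        (max x.1 y.1, min x.2 y.2)
        (mem_inf.2 ⟨I.lower _ _ _ _ hx (le_max_left _ _) (min_le_left _ _),
          J.lower _ _ _ _ hy (le_max_right _ _) (min_le_right _ _)⟩)
  map_top' := by
    refine eq_top_iff.2 (hf.r4.symm.le.trans (sSup_le ?_))
    rintro x ⟨p, q, rfl⟩
    exact le_iSup₂ (f := fun (x : ℚ × ℚ) (_ : x ∈ (⊤ : FrameOfReals).carrier) => f x.1 x.2)
      (p, q) (gen_le.1 le_top)
  map_sSup' S := by
    apply le_antisymm
    · let U : FrameOfReals :=
        { carrier := {x | f x.1 x.2 ≤ sSup ((fun I : FrameOfReals =>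
            ⨆ x ∈ I.carrier, f x.1 x.2) '' S)}
          lower := fun p q r s h h1 h2 => (hf.mono h1 h2).trans h
          glue := fun p q r s h1 h2 h3 h4 h5 => (hf.r2 p q r s h1 h2 h3).symm.le.trans
            (sup_le h4 h5)
          round := fun p q h => (hf.r3 p q).le.trans (sSup_le (by
            rintro x ⟨r, s, h1, h2, h3, rfl⟩
            exact h r s h1 h2 h3)) }
      have hU : sSup S ≤ U := sSup_le (fun I hI x hx =>
        (le_iSup₂ (f := fun (x : ℚ × ℚ) (_ : x ∈ I.carrier) => f x.1 x.2) x hx).trans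
          (le_sSup ⟨I, hI, rfl⟩))
      exact iSup₂_le (fun x hx => hU hx)
    · apply sSup_le
      rintro _ ⟨I, hI, rfl⟩
      exact iSup₂_le (fun x hx => le_iSup₂
        (f := fun (x : ℚ × ℚ) (_ : x ∈ (sSup S).carrier) => f x.1 x.2) x (le_sSup hI hx))

theorem lift_gen {L : Type u} [Order.Frame L] (f : ℚ → ℚ → L) (hf : Relations f) (p q : ℚ) :
    lift f hf (gen p q) = f p q := by
  apply le_antisymm
  · refine iSup₂_le (fun x hx => ?_)
    rcases (gen_le (I := principal p q)).2 (Or.inr ⟨le_rfl, le_rfl⟩) hx with h | h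
    · rw [hf.r3]
      refine sSup_le ?_
      rintro _ ⟨r, s, h1, h2, h3, -⟩
      exact absurd (h1.trans (h2.trans h3)) (not_lt.2 h)
    · exact hf.mono h.1 h.2
  · exact le_iSup₂ (f := fun (x : ℚ × ℚ) (_ : x ∈ (gen p q).carrier) => f x.1 x.2) (p, q)
      (gen_le.1 le_rfl)

/-- The universal property of `𝓛(ℝ)`, uniqueness. -/
theorem hom_ext {L : Type u} [Order.Frame L] {φ ψ : FrameHom FrameOfReals L}
    (h : ∀ p q : ℚ, φ (gen p q) = ψ (gen p q)) : φ = ψ := by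
  refine FrameHom.ext (fun I => ?_)
  rw [eq_iSup_gen I]
  simp only [map_iSup, h]

end FrameOfReals

namespace PointFree

variable {L : Type u} [Order.Frame L]

/-- `a ≺ b`: `a` is rather below `b`. -/
def RatherBelow (a b : L) : Prop := ∃ t : L, a ⊓ t = ⊥ ∧ t ⊔ b = ⊤

/-- `a ≺≺ b`: `a` is completely below `b`. Only the values of `c` on `ℚ ∩ [0, 1]` matter. -/
def CompletelyBelow (a b : L) : Prop :=
  ∃ c : ℚ → L, c 0 = a ∧ c 1 = b ∧ ∀ r s : ℚ, 0 ≤ r → r < s → s ≤ 1 → RatherBelow (c r) (c s)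

variable (L) in
/-- `L` is a completely regular frame. -/
def IsCompletelyRegular : Prop := ∀ a : L, a = sSup {x : L | CompletelyBelow x a}

variable (L) in
/-- (The underlying set of) the ring `𝓡L` of real-valued continuous functions on `L`: the frame
homomorphisms `𝓛(ℝ) → L`. -/
abbrev ContinuousReal : Type u := FrameHom FrameOfReals L

/-- The cozero element of `φ ∈ 𝓡L`: the join of all `φ(p, 0) ∨ φ(0, q)`. -/
def coz (φ : ContinuousReal L) : L :=
  ⨆ (p : ℚ) (q : ℚ), φ (FrameOfReals.gen p 0) ⊔ φ (FrameOfReals.gen 0 q)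

variable (L) in
/-- `Coz L`, the set of cozero elements of `L`. -/
def Coz : Set L := Set.range (coz : ContinuousReal L → L)

/-- `φ ∈ 𝓡L` is bounded. -/
def IsBounded (φ : ContinuousReal L) : Prop := ∃ p q : ℚ, φ (FrameOfReals.gen p q) = ⊤

variable (L) in
/-- `L` is pseudocompact: every element of `𝓡L` is bounded. -/
def IsPseudocompact : Prop := ∀ φ : ContinuousReal L, IsBounded φ

variable (L) in
/-- `L` is compact: its top element is a compact element. -/
def IsCompactFrame : Prop := IsCompactElement (⊤ : L)

variable (L) in
/-- `L` is a `P_F`-frame: of any two disjoint cozero elements at least one is complemented. -/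
def IsPFFrame : Prop :=
  ∀ a ∈ Coz L, ∀ b ∈ Coz L, a ⊓ b = ⊥ → IsComplemented a ∨ IsComplemented b

end PointFree

/-!
Suppose that `L` is infinite. Complete regularity makes every element a join of regular ones, so
the Boolean algebra of regular elements is infinite and contains an infinite sequence of nonzero
pairwise disjoint elements, which complete regularity shrinks to cozero elements `b n`. Countable
joins of cozero elements are cozero, so by the `P_F` property one of `⨆ n, b (2 * n)` and
`⨆ n, b (2 * n + 1)` is complemented. The function with value `n + 1` on the `n`-th piece of that
join and `0` on its complement is then continuous and unbounded, so `L` is not pseudocompact.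
Compactness implies pseudocompactness because `⊤` is the directed join of the `(-n, n)`.
Continuous functions are built from scales, as in Urysohn's lemma.
-/

namespace FrameOfReals

theorem gen_eq_bot {p q : ℚ} (h : q ≤ p) : gen p q = ⊥ := by
  rw [relations_gen.r3, sSup_eq_bot]
  rintro _ ⟨r, s, hpr, hrs, hsq, -⟩
  exact absurd (hpr.trans (hrs.trans hsq)) h.not_gt

theorem iSup_gen_neg_natCast : ⨆ n : ℕ, gen (-n) n = ⊤ := by
  rw [eq_top_iff, ← relations_gen.r4]
  refine sSup_le ?_
  rintro _ ⟨p, q, rfl⟩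
  obtain ⟨n, hn⟩ := exists_nat_gt (max (-p) q)
  rw [max_lt_iff] at hn
  exact le_iSup_of_le n (gen_mono (neg_lt.1 hn.1).le hn.2.le)

/-- The open set `{x | x < -r} ∪ {x | r < x}` of the real line. For `0 ≤ r` it is `{x | r < |x|}`;
for `r = 0` it is the cozero set of the identity function. -/
def outside (r : ℚ) : FrameOfReals := (⨆ p, gen p (-r)) ⊔ ⨆ q, gen r q

theorem gen_le_outside_of_le_neg {p q r : ℚ} (h : q ≤ -r) : gen p q ≤ outside r :=
  le_sup_of_le_left (le_iSup_of_le p (gen_mono le_rfl h))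

theorem gen_le_outside_of_le {p q r : ℚ} (h : r ≤ p) : gen p q ≤ outside r :=
  le_sup_of_le_right (le_iSup_of_le q (gen_mono h le_rfl))

theorem outside_anti : Antitone outside := fun _ _ h =>
  sup_le (iSup_le fun _ => gen_le_outside_of_le_neg (neg_le_neg h))
    (iSup_le fun _ => gen_le_outside_of_le h)

theorem disjoint_outside_gen (r : ℚ) : Disjoint (outside r) (gen (-r) r) := by
  refine disjoint_sup_left.2 ⟨iSup_disjoint_iff.2 fun p => ?_, iSup_disjoint_iff.2 fun q => ?_⟩
  · rw [disjoint_iff, relations_gen.r1]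
    exact gen_eq_bot ((min_le_left _ _).trans (le_max_right _ _))
  · rw [disjoint_iff, relations_gen.r1]
    exact gen_eq_bot ((min_le_right _ _).trans (le_max_left _ _))

theorem gen_sup_outside_eq_top {r s : ℚ} (hr : 0 ≤ r) (hrs : r < s) :
    gen (-s) s ⊔ outside r = ⊤ := by
  rw [eq_top_iff, ← relations_gen.r4]
  refine sSup_le ?_
  rintro _ ⟨p, q, rfl⟩
  have hp : min p (-s) ≤ -s := min_le_right _ _
  have hq : s ≤ max q s := le_max_right _ _
  calc gen p q ≤ gen (min p (-s)) (max q s) := gen_mono (min_le_left _ _) (le_max_left _ _)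
    _ = gen (min p (-s)) s ⊔ gen r (max q s) :=
        (relations_gen.r2 _ _ _ _ (by linarith) hrs hq).symm
    _ = gen (min p (-s)) (-r) ⊔ gen (-s) s ⊔ gen r (max q s) := by
        rw [relations_gen.r2 _ _ _ _ hp (neg_lt_neg hrs) (by linarith)]
    _ ≤ gen (-s) s ⊔ outside r :=
        sup_le (sup_le (le_sup_of_le_right (gen_le_outside_of_le_neg le_rfl)) le_sup_left)
          (le_sup_of_le_right (gen_le_outside_of_le le_rfl))

theorem outside_zero_eq_biSup :
    outside 0 = ⨆ q ∈ Set.Ico (0 : ℚ) 1, outside (1 - q) := by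
  refine le_antisymm (sup_le (iSup_le fun p => ?_) (iSup_le fun q => ?_))
    (iSup₂_le fun q hq => outside_anti (sub_nonneg.2 hq.2.le))
  · rw [neg_zero, relations_gen.r3]
    refine sSup_le ?_
    rintro _ ⟨r, s, -, -, hs, rfl⟩
    refine le_iSup₂_of_le (max 0 (1 + s)) ⟨le_max_left _ _, max_lt one_pos (by linarith)⟩
      (gen_le_outside_of_le_neg ?_)
    linarith [le_max_right 0 (1 + s)]
  · rw [relations_gen.r3]
    refine sSup_le ?_
    rintro _ ⟨r, s, hr, -, -, rfl⟩
    refine le_iSup₂_of_le (max 0 (1 - r)) ⟨le_max_left _ _, max_lt one_pos (by linarith)⟩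
      (gen_le_outside_of_le ?_)
    linarith [le_max_right 0 (1 - r)]

end FrameOfReals

namespace PointFree

open FrameOfReals Function Set

section RatherBelow

variable {L M : Type*} [Order.Frame L] [Order.Frame M] {a a' b b' : L}

theorem RatherBelow.codisjoint (h : RatherBelow a b) : Codisjoint aᶜ b := by
  obtain ⟨t, hat, htb⟩ := h
  exact (codisjoint_iff.2 htb).mono_left (le_compl_iff_disjoint_left.2 (disjoint_iff.2 hat))

theorem ratherBelow_of_codisjoint (h : Codisjoint aᶜ b) : RatherBelow a b :=
  ⟨aᶜ, inf_compl_self a, h.eq_top⟩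

theorem RatherBelow.le (h : RatherBelow a b) : a ≤ b := by
  obtain ⟨t, hat, htb⟩ := h
  exact (disjoint_iff.2 hat).le_of_codisjoint (codisjoint_iff.2 htb)

theorem RatherBelow.mono (h : RatherBelow a b) (ha : a' ≤ a) (hb : b ≤ b') :
    RatherBelow a' b' :=
  ratherBelow_of_codisjoint (h.codisjoint.mono (compl_le_compl ha) hb)

theorem ratherBelow_bot (b : L) : RatherBelow ⊥ b := ⟨⊤, bot_inf_eq _, top_sup_eq _⟩

theorem ratherBelow_top (a : L) : RatherBelow a ⊤ := ⟨⊥, inf_bot_eq _, bot_sup_eq _⟩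

theorem RatherBelow.sup (h : RatherBelow a b) (h' : RatherBelow a' b') :
    RatherBelow (a ⊔ a') (b ⊔ b') := by
  refine ratherBelow_of_codisjoint ?_
  rw [compl_sup, codisjoint_inf_left]
  exact ⟨h.codisjoint.mono_right le_sup_left, h'.codisjoint.mono_right le_sup_right⟩

theorem RatherBelow.finset_sup {ι : Type*} (F : Finset ι) {x y : ι → L}
    (h : ∀ i ∈ F, RatherBelow (x i) (y i)) : RatherBelow (F.sup x) (F.sup y) := by
  classical
  induction F using Finset.induction_on with
  | empty => exact ratherBelow_bot _
  | insert i F _ ih =>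
    rw [Finset.forall_mem_insert] at h
    simpa only [Finset.sup_insert] using h.1.sup (ih h.2)

theorem RatherBelow.compl_compl_le (h : RatherBelow a b) : aᶜᶜ ≤ b := by
  refine RatherBelow.le (ratherBelow_of_codisjoint ?_)
  rw [compl_compl_compl]
  exact h.codisjoint

theorem RatherBelow.map (φ : FrameHom L M) (h : RatherBelow a b) : RatherBelow (φ a) (φ b) := by
  obtain ⟨t, hat, htb⟩ := h
  exact ⟨φ t, by rw [← map_inf, hat, map_bot], by rw [← map_sup, htb, map_top]⟩

theorem CompletelyBelow.ratherBelow (h : CompletelyBelow a b) : RatherBelow a b := by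
  obtain ⟨c, rfl, rfl, hc⟩ := h
  exact hc 0 1 le_rfl one_pos le_rfl

theorem ratherBelow_outside {r s : ℚ} (hr : 0 ≤ r) (hrs : r < s) :
    RatherBelow (outside s) (outside r) :=
  ⟨gen (-s) s, (disjoint_outside_gen s).eq_bot, gen_sup_outside_eq_top hr hrs⟩

end RatherBelow

section Scale

variable {L M : Type*} [Order.Frame L] [Order.Frame M] {s : ℚ → L}

/-- A scale: a family that interpolates between the sublevels `{f < r}` and `{f ≤ r}` of a
real-valued continuous function `f` on `L`. -/
structure IsScale (s : ℚ → L) : Prop where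
  ratherBelow : ∀ ⦃p q⦄, p < q → RatherBelow (s p) (s q)
  iSup_eq_top : ⨆ r, s r = ⊤
  iSup_compl_eq_top : ⨆ r, (s r)ᶜ = ⊤

/-- The open sublevel `{f < q}` of the function `f` with scale `s`. -/
def sublevel (s : ℚ → L) (q : ℚ) : L := ⨆ r < q, s r

/-- The open superlevel `{p < f}` of the function `f` with scale `s`. -/
def superlevel (s : ℚ → L) (p : ℚ) : L := ⨆ r > p, (s r)ᶜ

theorem le_sublevel (s : ℚ → L) {r q : ℚ} (h : r < q) : s r ≤ sublevel s q :=
  le_iSup₂_of_le r h le_rfl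

theorem compl_le_superlevel (s : ℚ → L) {p r : ℚ} (h : p < r) : (s r)ᶜ ≤ superlevel s p :=
  le_iSup₂_of_le r h le_rfl

theorem sublevel_mono (s : ℚ → L) : Monotone (sublevel s) := fun _ _ h =>
  iSup₂_le fun _ hr => le_sublevel s (hr.trans_le h)

theorem superlevel_anti (s : ℚ → L) : Antitone (superlevel s) := fun _ _ h =>
  iSup₂_le fun _ hr => compl_le_superlevel s (h.trans_lt hr)

theorem sublevel_eq_biSup (s : ℚ → L) (q : ℚ) : sublevel s q = ⨆ r < q, sublevel s r := by
  refine le_antisymm (iSup₂_le fun r hr => ?_) (iSup₂_le fun r hr => sublevel_mono s hr.le)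
  obtain ⟨t, hrt, htq⟩ := exists_between hr
  exact le_iSup₂_of_le t htq (le_sublevel s hrt)

theorem superlevel_eq_biSup (s : ℚ → L) (p : ℚ) :
    superlevel s p = ⨆ r > p, superlevel s r := by
  refine le_antisymm (iSup₂_le fun r hr => ?_) (iSup₂_le fun r hr => superlevel_anti s hr.le)
  obtain ⟨t, hpt, htr⟩ := exists_between hr
  exact le_iSup₂_of_le t hpt (compl_le_superlevel s htr)

theorem map_sublevel (φ : FrameHom L M) (s : ℚ → L) (q : ℚ) :
    φ (sublevel s q) = sublevel (φ ∘ s) q := by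
  simp only [sublevel, map_iSup, comp_apply]

theorem sublevel_iSup {ι : Sort*} (s : ι → ℚ → L) (q : ℚ) :
    sublevel (fun r => ⨆ i, s i r) q = ⨆ i, sublevel (s i) q := by
  simp only [sublevel, iSup_comm (ι := ι)]

theorem sublevel_comp_mul (s : ℚ → L) {c : ℚ} (hc : 0 < c) (q : ℚ) :
    sublevel (fun r => s (r * c)) q = sublevel s (q * c) := by
  refine le_antisymm (iSup₂_le fun r hr => le_sublevel s (mul_lt_mul_of_pos_right hr hc))
    (iSup₂_le fun r hr => le_iSup₂_of_le (r / c) ((div_lt_iff₀ hc).2 hr) ?_)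
  simp only [div_mul_cancel₀ r hc.ne', le_rfl]

namespace IsScale

theorem monotone (hs : IsScale s) : Monotone s :=
  monotone_iff_forall_lt.2 fun _ _ h => (hs.ratherBelow h).le

theorem sublevel_le (hs : IsScale s) (q : ℚ) : sublevel s q ≤ s q :=
  iSup₂_le fun _ hr => hs.monotone hr.le

theorem disjoint_superlevel_sublevel (hs : IsScale s) {p q : ℚ} (h : q ≤ p) :
    Disjoint (superlevel s p) (sublevel s q) :=
  iSup₂_disjoint_iff.2 fun _ hr =>
    disjoint_compl_left.mono_right ((hs.sublevel_le q).trans (hs.monotone (h.trans hr.le)))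

theorem codisjoint_superlevel_sublevel (hs : IsScale s) {p q : ℚ} (h : p < q) :
    Codisjoint (superlevel s p) (sublevel s q) := by
  obtain ⟨r, hpr, hrq⟩ := exists_between h
  obtain ⟨t, hrt, htq⟩ := exists_between hrq
  exact (hs.ratherBelow hrt).codisjoint.mono (compl_le_superlevel s hpr) (le_sublevel s htq)

theorem iSup_sublevel (hs : IsScale s) : ⨆ q, sublevel s q = ⊤ :=
  eq_top_mono (iSup_mono' fun r => ⟨r + 1, le_sublevel s (lt_add_one r)⟩) hs.iSup_eq_top

theorem iSup_superlevel (hs : IsScale s) : ⨆ p, superlevel s p = ⊤ :=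
  eq_top_mono (iSup_mono' fun r => ⟨r - 1, compl_le_superlevel s (sub_one_lt r)⟩)
    hs.iSup_compl_eq_top

theorem relations (hs : IsScale s) :
    Relations fun p q => superlevel s p ⊓ sublevel s q where
  r1 p q r t := by
    rw [(superlevel_anti s).map_sup, (sublevel_mono s).map_inf, inf_inf_inf_comm]
  r2 p q r t hpr hrq hqt := by
    rw [sup_inf_left, sup_inf_right, sup_inf_right, sup_eq_left.2 (superlevel_anti s hpr),
      sup_comm (sublevel s q), (hs.codisjoint_superlevel_sublevel hrq).eq_top,
      (hs.codisjoint_superlevel_sublevel (hpr.trans_lt (hrq.trans_le hqt))).eq_top,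
      sup_eq_right.2 (sublevel_mono s hqt), inf_top_eq, top_inf_eq]
  r3 p q := by
    refine le_antisymm ?_ (sSup_le ?_)
    · rw [superlevel_eq_biSup s p, sublevel_eq_biSup s q]
      simp only [iSup_inf_eq, inf_iSup_eq, iSup_le_iff]
      intro t htq r hpr
      rcases lt_or_ge r t with h | h
      · exact le_sSup ⟨r, t, hpr, h, htq, rfl⟩
      · exact (hs.disjoint_superlevel_sublevel h).eq_bot.trans_le bot_le
    · rintro _ ⟨r, t, hpr, -, htq, rfl⟩
      exact inf_le_inf (superlevel_anti s hpr.le) (sublevel_mono s htq.le)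
  r4 := by
    refine eq_top_mono (iSup_le fun x : ℚ × ℚ => le_sSup ⟨x.1, x.2, rfl⟩) ?_
    rw [← iSup_inf_iSup, hs.iSup_superlevel, hs.iSup_sublevel, inf_top_eq]

end IsScale

/-- A scale of a function with values in `[-1, 0]`. -/
structure IsUnitScale (s : ℚ → L) : Prop where
  ratherBelow : ∀ ⦃p q⦄, p < q → RatherBelow (s p) (s q)
  eq_bot : ∀ ⦃r⦄, r < -1 → s r = ⊥
  eq_top : ∀ ⦃r⦄, 0 ≤ r → s r = ⊤

/-- The family `c`, of which only the values on `[0, 1)` matter, moved to `[-1, 0)` and extended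
by `⊥` and `⊤` to a candidate for a unit scale. -/
def unitScale (c : ℚ → L) (r : ℚ) : L :=
  if 0 ≤ r then ⊤ else if r < -1 then ⊥ else c (1 + r)

theorem isUnitScale_unitScale {c : ℚ → L}
    (hc : ∀ r s, 0 ≤ r → r < s → s < 1 → RatherBelow (c r) (c s)) :
    IsUnitScale (unitScale c) where
  ratherBelow p q hpq := by
    rcases le_or_gt 0 q with hq | hq
    · rw [unitScale.eq_def c q, if_pos hq]
      exact ratherBelow_top _
    rcases lt_or_ge p (-1) with hp | hp
    · rw [unitScale, if_neg (hpq.trans hq).not_ge, if_pos hp]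
      exact ratherBelow_bot _
    · rw [unitScale, unitScale, if_neg (hpq.trans hq).not_ge, if_neg hp.not_gt, if_neg hq.not_ge,
        if_neg (hp.trans hpq.le).not_gt]
      exact hc _ _ (by linarith) (by linarith) (by linarith)
  eq_bot r hr := by rw [unitScale, if_neg (by linarith), if_pos hr]
  eq_top r hr := by rw [unitScale, if_pos hr]

theorem sublevel_unitScale_zero (c : ℚ → L) :
    sublevel (unitScale c) 0 = ⨆ q ∈ Ico (0 : ℚ) 1, c q := by
  refine le_antisymm (iSup₂_le fun r hr => ?_) (iSup₂_le fun q hq => ?_)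
  · rw [unitScale, if_neg hr.not_ge]
    split_ifs with hr'
    · exact bot_le
    · exact le_iSup₂_of_le (1 + r) ⟨by linarith, by linarith⟩ le_rfl
  · refine le_iSup₂_of_le (q - 1) (sub_neg.2 hq.2) ?_
    rw [unitScale, if_neg (sub_neg.2 hq.2).not_ge, if_neg (by linarith [hq.1]),
      add_sub_cancel]

namespace IsUnitScale

theorem isScale (hs : IsUnitScale s) : IsScale s where
  ratherBelow := hs.ratherBelow
  iSup_eq_top := eq_top_mono (le_iSup s 0) (hs.eq_top le_rfl)
  iSup_compl_eq_top := by
    refine eq_top_mono (le_iSup (fun r => (s r)ᶜ) (-2)) ?_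
    rw [hs.eq_bot (by norm_num), compl_bot]

theorem superlevel_zero (hs : IsUnitScale s) : superlevel s 0 = ⊥ :=
  iSup₂_eq_bot.2 fun _ hr => by rw [hs.eq_top hr.le, compl_top]

theorem map (φ : FrameHom L M) (hs : IsUnitScale s) : IsUnitScale (φ ∘ s) where
  ratherBelow _ _ h := (hs.ratherBelow h).map φ
  eq_bot _ h := by rw [comp_apply, hs.eq_bot h, map_bot]
  eq_top _ h := by rw [comp_apply, hs.eq_top h, map_top]

theorem exists_iSup_comp_mul_le_sup {s : ℕ → ℚ → L} (hs : ∀ n, IsUnitScale (s n)) {r : ℚ}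
    (hr : r < 0) :
    ∃ N : ℕ, ⨆ n : ℕ, s n (r * (n + 1)) ≤ (Finset.range N).sup fun n => s n (r * (n + 1)) := by
  obtain ⟨N, hN⟩ := exists_nat_gt (-r)⁻¹
  rw [inv_lt_iff_one_lt_mul₀ (neg_pos.2 hr)] at hN
  refine ⟨N, iSup_le fun n => ?_⟩
  rcases lt_or_ge n N with hn | hn
  · exact Finset.le_sup (f := fun n : ℕ => s n (r * (n + 1))) (Finset.mem_range.2 hn)
  · have hNn : (N : ℚ) ≤ n := by exact_mod_cast hn
    rw [(hs n).eq_bot (by nlinarith)]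
    exact bot_le

/-- If `s n` is the scale of `f n`, this is the scale of the infimum of the `f n / (n + 1)`. The
weights make all but finitely many terms `⊥` at each `r < 0`, which is what makes `≺` survive the
infinite join. -/
theorem iSup_comp_mul {s : ℕ → ℚ → L} (hs : ∀ n, IsUnitScale (s n)) :
    IsUnitScale fun r => ⨆ n : ℕ, s n (r * (n + 1)) := by
  have eq_top {r : ℚ} (hr : 0 ≤ r) : ⨆ n : ℕ, s n (r * (n + 1)) = ⊤ :=
    eq_top_mono (le_iSup (fun n : ℕ => s n (r * (n + 1))) 0) ((hs 0).eq_top (by simpa))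
  refine ⟨fun p q hpq => ?_, fun r hr => iSup_eq_bot.2 fun n => ?_, fun r => eq_top⟩
  · rcases le_or_gt 0 q with hq | hq
    · exact (eq_top hq).symm ▸ ratherBelow_top _
    · obtain ⟨N, hN⟩ := exists_iSup_comp_mul_le_sup hs (hpq.trans hq)
      refine (RatherBelow.finset_sup (Finset.range N) fun n _ => ?_).mono hN
        (Finset.sup_le fun n _ => le_iSup (fun n : ℕ => s n (q * (n + 1))) n)
      exact (hs n).ratherBelow (mul_lt_mul_of_pos_right hpq n.cast_add_one_pos)
  · exact (hs n).eq_bot (by nlinarith [n.cast_nonneg (α := ℚ)])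

end IsUnitScale

end Scale

section Cozero

variable {L : Type u} [Order.Frame L]

/-- The real-valued continuous function with scale `s`. -/
noncomputable def IsScale.toReal {s : ℚ → L} (hs : IsScale s) : ContinuousReal L :=
  FrameOfReals.lift _ hs.relations

theorem IsScale.toReal_gen {s : ℚ → L} (hs : IsScale s) (p q : ℚ) :
    hs.toReal (gen p q) = superlevel s p ⊓ sublevel s q :=
  lift_gen _ hs.relations p q

theorem coz_eq_map_outside (φ : ContinuousReal L) : coz φ = φ (outside 0) := by
  simp only [coz, outside, map_sup, map_iSup, neg_zero, sup_iSup, iSup_sup]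
  exact iSup_comm

theorem IsScale.coz_toReal {s : ℚ → L} (hs : IsScale s) :
    coz hs.toReal = sublevel s 0 ⊔ superlevel s 0 := by
  simp only [coz_eq_map_outside, outside, map_sup, map_iSup, neg_zero, toReal_gen, ← iSup_inf_eq,
    ← inf_iSup_eq, hs.iSup_superlevel, hs.iSup_sublevel, top_inf_eq, inf_top_eq]

theorem IsUnitScale.sublevel_zero_mem_Coz {s : ℚ → L} (hs : IsUnitScale s) :
    sublevel s 0 ∈ Coz L :=
  ⟨hs.isScale.toReal, by rw [hs.isScale.coz_toReal, hs.superlevel_zero, sup_bot_eq]⟩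

/-- The unit scale of `φ` is that of `-min |φ| 1`. -/
theorem exists_isUnitScale_of_mem_Coz {a : L} (ha : a ∈ Coz L) :
    ∃ s, IsUnitScale s ∧ sublevel s 0 = a := by
  obtain ⟨φ, rfl⟩ := ha
  have hs : IsUnitScale (unitScale fun r => outside (1 - r)) :=
    isUnitScale_unitScale fun r s _ hrs hs =>
      ratherBelow_outside (sub_nonneg.2 hs.le) (sub_lt_sub_left hrs 1)
  refine ⟨_, hs.map φ, ?_⟩
  rw [← map_sublevel, sublevel_unitScale_zero, ← outside_zero_eq_biSup, coz_eq_map_outside]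

theorem iSup_mem_Coz {a : ℕ → L} (ha : ∀ n, a n ∈ Coz L) : ⨆ n, a n ∈ Coz L := by
  choose s hs hsa using fun n => exists_isUnitScale_of_mem_Coz (ha n)
  have hsup : sublevel (fun r => ⨆ n : ℕ, s n (r * (n + 1))) 0 = ⨆ n, a n := by
    simp only [sublevel_iSup, sublevel_comp_mul _ (Nat.cast_add_one_pos _), zero_mul, hsa]
  exact hsup ▸ (IsUnitScale.iSup_comp_mul hs).sublevel_zero_mem_Coz

theorem CompletelyBelow.exists_mem_Coz_between {a b : L} (h : CompletelyBelow a b) :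
    ∃ c ∈ Coz L, a ≤ c ∧ c ≤ b := by
  obtain ⟨c, rfl, rfl, hc⟩ := h
  have hs : IsUnitScale (unitScale c) :=
    isUnitScale_unitScale fun r s hr hrs hs => hc r s hr hrs hs.le
  refine ⟨_, hs.sublevel_zero_mem_Coz, ?_⟩
  rw [sublevel_unitScale_zero]
  exact ⟨le_iSup₂_of_le 0 ⟨le_rfl, one_pos⟩ le_rfl,
    iSup₂_le fun q hq => (hc q 1 hq.1 hq.2 le_rfl).le⟩

theorem IsCompletelyRegular.exists_mem_Coz_ne_bot_le (hreg : IsCompletelyRegular L) {a : L}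
    (ha : a ≠ ⊥) : ∃ c ∈ Coz L, c ≠ ⊥ ∧ c ≤ a := by
  rw [hreg a, Ne, sSup_eq_bot] at ha
  push Not at ha
  obtain ⟨x, hxa, hx⟩ := ha
  obtain ⟨c, hc, hxc, hca⟩ := hxa.exists_mem_Coz_between
  exact ⟨c, hc, ne_bot_of_le_ne_bot hx hxc, hca⟩

end Cozero

section Pseudocompact

variable {L : Type u} [Order.Frame L]

theorem IsCompactFrame.isPseudocompact (h : IsCompactFrame L) : IsPseudocompact L := by
  intro φ
  have hmono : Monotone fun n : ℕ => φ (gen (-n) n) := fun m n hmn =>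
    OrderHomClass.mono φ (gen_mono (neg_le_neg (Nat.cast_le.2 hmn)) (Nat.cast_le.2 hmn))
  have hsup : ⨆ n : ℕ, φ (gen (-n) n) = ⊤ := by rw [← map_iSup, iSup_gen_neg_natCast, map_top]
  obtain ⟨_, ⟨n, rfl⟩, hn⟩ := h _ ⊤ (range_nonempty _) hmono.directed_le.directedOn_range
    (hsup ▸ isLUB_iSup) le_rfl
  exact ⟨-n, n, top_le_iff.1 hn⟩

theorem IsPseudocompact.exists_eq_top (hps : IsPseudocompact L) {s : ℚ → L} (hs : IsScale s) :
    ∃ q, s q = ⊤ := by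
  obtain ⟨p, q, h⟩ := hps hs.toReal
  rw [hs.toReal_gen, inf_eq_top_iff] at h
  exact ⟨q, eq_top_mono (hs.sublevel_le q) h.2⟩

/-- The scale of the function with value `n` on `b n`, where the `b n` partition `⊤`. -/
def stepScale (b : ℕ → L) (r : ℚ) : L := ⨆ n : ℕ, ⨆ _ : (n : ℚ) < r, b n

theorem le_stepScale (b : ℕ → L) {n : ℕ} {r : ℚ} (h : n < r) : b n ≤ stepScale b r :=
  le_iSup₂_of_le n h le_rfl

theorem disjoint_stepScale {b : ℕ → L} (hb : Pairwise (Disjoint on b)) {n : ℕ} {r : ℚ}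
    (hr : r ≤ n) : Disjoint (b n) (stepScale b r) :=
  disjoint_iSup₂_iff.2 fun _ hm => hb fun hnm => (hr.trans_eq (congrArg _ hnm)).not_gt hm

theorem isScale_stepScale {b : ℕ → L} (hb : Pairwise (Disjoint on b)) (htop : ⨆ n, b n = ⊤) :
    IsScale (stepScale b) where
  ratherBelow p q hpq := by
    refine ⟨⨆ n : ℕ, ⨆ _ : p ≤ n, b n, disjoint_iff.1 ?_, eq_top_mono (iSup_le fun n => ?_) htop⟩
    · exact disjoint_iSup₂_iff.2 fun n hn => (disjoint_stepScale hb hn).symm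
    · rcases le_or_gt p n with h | h
      · exact le_sup_of_le_left (le_iSup₂_of_le n h le_rfl)
      · exact le_sup_of_le_right (le_stepScale b (h.trans hpq))
  iSup_eq_top :=
    eq_top_mono (iSup_mono' fun n : ℕ => ⟨(n : ℚ) + 1, le_stepScale b (lt_add_one _)⟩) htop
  iSup_compl_eq_top := by
    refine eq_top_mono (le_iSup (fun r => (stepScale b r)ᶜ) 0) ?_
    rw [← compl_bot]
    exact congrArg compl (iSup₂_eq_bot.2 fun n hn => absurd hn n.cast_nonneg.not_gt)

theorem IsPseudocompact.exists_eq_bot_of_iSup_eq_top (hps : IsPseudocompact L) {b : ℕ → L}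
    (hb : Pairwise (Disjoint on b)) (htop : ⨆ n, b n = ⊤) : ∃ N, ∀ n ≥ N, b n = ⊥ := by
  obtain ⟨q, hq⟩ := hps.exists_eq_top (isScale_stepScale hb htop)
  obtain ⟨N, hN⟩ := exists_nat_gt q
  refine ⟨N, fun n hn => ?_⟩
  have h := disjoint_stepScale hb (hN.le.trans (Nat.cast_le.2 hn))
  rwa [hq, disjoint_top] at h

theorem IsPseudocompact.exists_eq_bot_of_isComplemented_iSup (hps : IsPseudocompact L)
    {b : ℕ → L} (hb : Pairwise (Disjoint on b)) (hc : IsComplemented (⨆ n, b n)) :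
    ∃ n, b n = ⊥ := by
  obtain ⟨w, hw⟩ := hc
  let b' : ℕ → L := fun n => n.casesOn w b
  have htop : ⨆ n, b' n = ⊤ := by rw [← sup_iSup_nat_succ, sup_comm]; exact hw.sup_eq_top
  have hwb : ∀ n, Disjoint w (b n) := disjoint_iSup_iff.1 hw.disjoint.symm
  have hb' : Pairwise (Disjoint on b')
    | 0, 0, h => absurd rfl h
    | 0, n + 1, _ => hwb n
    | m + 1, 0, _ => (hwb m).symm
    | m + 1, n + 1, h => hb (ne_of_apply_ne _ h)
  obtain ⟨N, hN⟩ := hps.exists_eq_bot_of_iSup_eq_top hb' htop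
  exact ⟨N, hN (N + 1) N.le_succ⟩

end Pseudocompact

section DisjointSequence

theorem exists_lt_infinite_Iic {B : Type*} [GeneralizedBooleanAlgebra B] {a : B}
    (ha : (Iic a).Infinite) : ∃ b < a, (Iic b).Infinite := by
  obtain ⟨y, hya, hy⟩ := ha.exists_notMem_finite (toFinite {⊥, a})
  simp only [mem_insert_iff, mem_singleton_iff, not_or] at hy
  by_cases h : (Iic y).Infinite
  · exact ⟨y, lt_of_le_of_ne hya hy.2, h⟩
  refine ⟨a \ y, sdiff_lt hya hy.1, fun h' => ha ?_⟩
  refine ((not_infinite.1 h).image2 (· ⊔ ·) h').subset fun z hz => ?_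
  exact ⟨z ⊓ y, inf_le_right, z \ y, sdiff_le_sdiff_right hz, sup_inf_sdiff z y⟩

theorem pairwise_disjoint_sdiff_succ {B : Type*} [GeneralizedBooleanAlgebra B] {f : ℕ → B}
    (hf : Antitone f) : Pairwise (Disjoint on fun n => f n \ f (n + 1)) :=
  (pairwise_disjoint_on _).2 fun _ _ hmn =>
    disjoint_sdiff_self_left.mono_right (sdiff_le.trans (hf hmn))

theorem exists_pairwise_disjoint_ne_bot (B : Type*) [BooleanAlgebra B] [Infinite B] :
    ∃ x : ℕ → B, (∀ n, x n ≠ ⊥) ∧ Pairwise (Disjoint on x) := by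
  have : Nonempty {a : B // (Iic a).Infinite} := ⟨⊤, Iic_top (α := B) ▸ infinite_univ⟩
  have : NoMinOrder {a : B // (Iic a).Infinite} :=
    ⟨fun a => let ⟨b, hba, hb⟩ := exists_lt_infinite_Iic a.2; ⟨⟨b, hb⟩, hba⟩⟩
  obtain ⟨f, hf⟩ := Nat.exists_strictAnti {a : B // (Iic a).Infinite}
  exact ⟨fun n => f n \ f (n + 1), fun n h => (hf n.lt_succ_self).not_ge (sdiff_eq_bot_iff.1 h),
    pairwise_disjoint_sdiff_succ (f := fun n => (f n).1) fun _ _ h => hf.antitone h⟩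

variable {L : Type*} [Order.Frame L]

variable (L) in
/-- `L` is a semiregular frame: its regular elements, those with `aᶜᶜ = a`, generate it under
joins. -/
def IsSemiregular : Prop := ∀ a : L, a = sSup {x | Heyting.IsRegular x ∧ x ≤ a}

theorem IsCompletelyRegular.isSemiregular (hreg : IsCompletelyRegular L) : IsSemiregular L := by
  refine fun a => le_antisymm ?_ (sSup_le fun x hx => hx.2)
  conv_lhs => rw [hreg a]
  exact sSup_le fun x hx => le_compl_compl.trans
    (le_sSup ⟨Heyting.isRegular_compl _, hx.ratherBelow.compl_compl_le⟩)

theorem IsSemiregular.finite_of_finite_regular (h : IsSemiregular L) [Finite (Heyting.Regular L)] :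
    Finite L := by
  refine Finite.of_injective (fun a => {r : Heyting.Regular L | (r : L) ≤ a}) fun a b hab => ?_
  rw [h a, h b]
  exact congrArg sSup (ext fun x => and_congr_right fun hx => Set.ext_iff.1 hab ⟨x, hx⟩)

theorem IsSemiregular.exists_pairwise_disjoint_ne_bot (h : IsSemiregular L) [Infinite L] :
    ∃ x : ℕ → L, (∀ n, x n ≠ ⊥) ∧ Pairwise (Disjoint on x) := by
  have : Infinite (Heyting.Regular L) :=
    not_finite_iff_infinite.1 fun _ => h.finite_of_finite_regular.false
  obtain ⟨x, hx, hd⟩ := PointFree.exists_pairwise_disjoint_ne_bot (Heyting.Regular L)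
  refine ⟨fun n => x n, fun n hn => hx n (Heyting.Regular.coe_injective hn), fun m n hmn => ?_⟩
  exact disjoint_iff.2 (congrArg Subtype.val (hd hmn).eq_bot)

end DisjointSequence

theorem IsCompletelyRegular.exists_pairwise_disjoint_mem_Coz {L : Type u} [Order.Frame L]
    [Infinite L] (hreg : IsCompletelyRegular L) :
    ∃ b : ℕ → L, (∀ n, b n ∈ Coz L) ∧ (∀ n, b n ≠ ⊥) ∧ Pairwise (Disjoint on b) := by
  obtain ⟨x, hx, hd⟩ := hreg.isSemiregular.exists_pairwise_disjoint_ne_bot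
  choose b hcoz hb hbx using fun n => hreg.exists_mem_Coz_ne_bot_le (hx n)
  exact ⟨b, hcoz, hb, fun m n hmn => (hd hmn).mono (hbx m) (hbx n)⟩

end PointFree

theorem mainTheorem11 (L : Type u) [Order.Frame L]
    (hreg : PointFree.IsCompletelyRegular L) (hPF : PointFree.IsPFFrame L) :
    (PointFree.IsCompactFrame L → Finite L) ∧ (PointFree.IsPseudocompact L → Finite L) := by
  suffices finite_of_pseudocompact : PointFree.IsPseudocompact L → Finite L from
    ⟨fun hc => finite_of_pseudocompact hc.isPseudocompact, finite_of_pseudocompact⟩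
  intro hps
  by_contra hinf
  have : Infinite L := not_finite_iff_infinite.1 hinf
  obtain ⟨b, hcoz, hb, hd⟩ := hreg.exists_pairwise_disjoint_mem_Coz
  have hdisj : Disjoint (⨆ n, b (2 * n)) (⨆ n, b (2 * n + 1)) := by
    simp only [iSup_disjoint_iff, disjoint_iSup_iff]
    exact fun m n => hd (by omega)
  have not_isComplemented {k : ℕ → ℕ} (hk : k.Injective) : ¬ IsComplemented (⨆ n, b (k n)) := by
    intro hc
    obtain ⟨n, hn⟩ := hps.exists_eq_bot_of_isComplemented_iSup (hd.comp_of_injective hk) hc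
    exact hb _ hn
  rcases hPF _ (PointFree.iSup_mem_Coz fun n => hcoz _) _ (PointFree.iSup_mem_Coz fun n => hcoz _)
    hdisj.eq_bot with h | h
  · exact not_isComplemented (fun m n h => by omega) h
  · exact not_isComplemented (fun m n h => by omega) h
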